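/- Let $u\in\mathbb{C}[t]$ be a polynomial of degree exactly $2$ (its roots may be simple or double), and let $q,n\in\mathbb{Z}$ with $q^2\neq 1$, $n$ odd and $|n|<2|q|$. Then all the solutions of the Riccati equation $$y'=y^2+\frac{1-q^2}{4}\,\frac{(u')^2-2uu''}{u^2}+\frac{1-n^2}{8}\,\frac{u''}{u}$$ are meromorphic on $\mathbb{C}$, and indeed rational. That is: if $U\subset\mathbb{C}$ is a nonempty connected open set containing no zero of $u$ and $y\colon U\to\mathbb{C}$ is a holomorphic solution of the equation, then there is a rational function $R\in\mathbb{C}(t)$ such that $y=R$ on $U$ and such that $R$, as a meromorphic function on $\mathbb{C}$, satisfies the equation at every point that is neither a zero of $u$ nor a pole of $R$. -/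

import Mathlib

open Polynomial

noncomputable section

/-- The rational function
`(1 - q²)/4 · ((u')² - 2 u u'')/u² + (1 - n²)/8 · u''/u`, evaluated at `t`
(only used at points where `u` does not vanish). -/
def riccatiCoeff (q n : ℤ) (u : ℂ[X]) (t : ℂ) : ℂ :=
  (1 - (q : ℂ) ^ 2) / 4 *
      (((derivative u).eval t ^ 2 - 2 * u.eval t * (derivative (derivative u)).eval t)
        / u.eval t ^ 2)
    + (1 - (n : ℂ) ^ 2) / 8 * ((derivative (derivative u)).eval t / u.eval t)

/-- On the set `U`, the function `y` is a (complex-differentiable) solution of the Riccati equation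
`y' = y² + (1 - q²)/4 · ((u')² - 2 u u'')/u² + (1 - n²)/8 · u''/u`; the set `U` has to avoid
the zeros of `u`, where the equation is not defined. -/
def IsRiccatiSolutionOn (q n : ℤ) (u : ℂ[X]) (y : ℂ → ℂ) (U : Set ℂ) : Prop :=
  ∀ t ∈ U, u.eval t ≠ 0 ∧ HasDerivAt y (y t ^ 2 + riccatiCoeff q n u t) t

/-- The function `ℂ → ℂ` given by a rational function (in lowest terms; the value at the finitely
many poles is `0`). -/
def ratFun (R : RatFunc ℂ) (t : ℂ) : ℂ := R.eval (RingHom.id ℂ) t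

end

/-!
Put `α = |q| - (n + 1) / 2` and `β = |q| + (n - 1) / 2`; these are natural numbers whose sum is odd.
With `z' = -y z` and `z = u ^ ((1 - α - β) / 4) P`, the Riccati equation becomes the linear
equation `2 u P'' - (α + β - 1) u' P' + α β u'' P = 0`. Since `(u')² - 2 u u''` is the constant
`discr u`, the operator on the left sends `(u') ^ i` to
`(i - α) (i - β) u'' (u') ^ i - i (i - 1) discr u u'' (u') ^ (i - 2)`. As `α` and `β` have opposite
parities, `(i - α) (i - β)` does not vanish for `i < α` of the parity of `α`, so `(u') ^ α` can be
corrected by lower powers of `u'` to a solution of degree `α`, and likewise for `β`. The two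
polynomials span the solution space, hence `y = -z'/z` is rational.
-/

section PolynomialSolutions

variable {R : Type*} [CommRing R]

/-- The operator `P ↦ 2 u P'' - (α + β - 1) u' P' + α β u'' P` of hypergeometric type; for
`u = X ^ 2 - 1` it is, up to a factor, the Gegenbauer operator whose exponents at infinity are
`-α` and `-β`. -/
noncomputable def gegenbauerOp (u : R[X]) (α β : R) : R[X] →ₗ[R] R[X] :=
  LinearMap.mulLeft R (2 * u) ∘ₗ derivative ∘ₗ derivative
    - LinearMap.mulLeft R (C (α + β - 1) * derivative u) ∘ₗ derivative
    + LinearMap.mulLeft R (C (α * β) * derivative (derivative u))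

theorem gegenbauerOp_apply (u : R[X]) (α β : R) (P : R[X]) :
    gegenbauerOp u α β P = 2 * u * derivative (derivative P)
      - C (α + β - 1) * derivative u * derivative P
      + C (α * β) * derivative (derivative u) * P :=
  rfl

theorem gegenbauerOp_comm (u : R[X]) (α β : R) : gegenbauerOp u α β = gegenbauerOp u β α := by
  refine LinearMap.ext fun P => ?_
  rw [gegenbauerOp_apply, gegenbauerOp_apply, add_comm α, mul_comm α]

theorem eq_quadratic_of_natDegree_eq_two {S : Type*} [Semiring S] {u : S[X]}
    (hu : u.natDegree = 2) :
    u = C (u.coeff 0) + C (u.coeff 1) * X + C (u.coeff 2) * X ^ 2 := by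
  conv_lhs => rw [u.as_sum_range_C_mul_X_pow, hu]
  simp [Finset.sum_range_succ]

theorem derivative_derivative_of_natDegree_eq_two {u : R[X]} (hu : u.natDegree = 2) :
    derivative (derivative u) = C (2 * u.coeff 2) := by
  nth_rw 1 [eq_quadratic_of_natDegree_eq_two hu]
  simp only [derivative_add, derivative_mul, derivative_C, derivative_X, derivative_X_sq, zero_mul,
    zero_add, mul_one, C_mul, C_ofNat, derivative_ofNat]
  ring

theorem derivative_sq_sub_eq_C_discr {u : R[X]} (hu : u.natDegree = 2) :
    derivative u ^ 2 - 2 * u * derivative (derivative u) = C u.discr := by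
  rw [derivative_derivative_of_natDegree_eq_two hu,
    discr_of_degree_eq_two ((degree_eq_iff_natDegree_eq_of_pos two_pos).2 hu)]
  nth_rw 1 2 [eq_quadratic_of_natDegree_eq_two hu]
  simp only [derivative_add, derivative_mul, derivative_C, derivative_X, derivative_X_sq, zero_mul,
    zero_add, mul_one, C_sub, C_mul, C_pow, C_ofNat]
  ring

theorem degree_derivative_pow_of_natDegree_eq_two [IsDomain R] [CharZero R] {u : R[X]}
    (hu : u.natDegree = 2) (i : ℕ) : (derivative u ^ i).degree = i := by
  rw [degree_pow, degree_derivative (by omega), hu, Nat.add_one_sub_one, Nat.cast_one, nsmul_one]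

theorem gegenbauerOp_derivative_pow {u : R[X]} (hu : u.natDegree = 2) (α β : R) (i : ℕ) :
    gegenbauerOp u α β (derivative u ^ i) =
      ((i - α) * (i - β)) • (derivative (derivative u) * derivative u ^ i)
        - (u.discr * (i * (i - 1))) •
          (derivative (derivative u) * derivative u ^ (i - 2)) := by
  have hdiscr := derivative_sq_sub_eq_C_discr hu
  have hthird : derivative (derivative (derivative u)) = 0 := by
    rw [derivative_derivative_of_natDegree_eq_two hu, derivative_C]
  rw [gegenbauerOp_apply]
  simp only [smul_eq_C_mul, C_mul, C_sub, C_add, ← hdiscr]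
  rcases i with _ | _ | i
  · simp
  · simp only [zero_add, pow_one, hthird, map_one, Nat.cast_one]
    ring
  · simp only [derivative_pow, Nat.cast_add, Nat.cast_one, map_add, map_natCast, map_one,
      add_tsub_cancel_right, derivative_mul, derivative_natCast, derivative_one,
      hthird, Nat.reduceSubDiff]
    ring

variable {K : Type*} [Field K] [CharZero K]

theorem exists_degree_eq_gegenbauerOp_eq {u : K[X]} (hu : u.natDegree = 2) {d d' : ℕ}
    (hodd : Odd (d + d')) (i : ℕ) (hi : Even (i + d)) (hid : i ≤ d) :
    ∃ P : K[X], P.degree = i ∧ gegenbauerOp u (d : K) d' P =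
      (((i : K) - d) * (i - d')) • (derivative (derivative u) * derivative u ^ i) := by
  induction i using Nat.twoStepInduction with
  | zero =>
    refine ⟨derivative u ^ 0, degree_derivative_pow_of_natDegree_eq_two hu 0, ?_⟩
    rw [gegenbauerOp_derivative_pow hu]
    simp
  | one =>
    refine ⟨derivative u ^ 1, degree_derivative_pow_of_natDegree_eq_two hu 1, ?_⟩
    rw [gegenbauerOp_derivative_pow hu]
    simp
  | more i ih _ =>
    obtain ⟨P, hPdeg, hP⟩ := ih (by grind) (by omega)
    have hd : (i : K) - d ≠ 0 := sub_ne_zero.2 (by exact_mod_cast (by omega : i ≠ d))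
    have hd' : (i : K) - d' ≠ 0 := sub_ne_zero.2 (by exact_mod_cast (by grind : i ≠ d'))
    have hpow := degree_derivative_pow_of_natDegree_eq_two hu (i + 2)
    set m : K := u.discr * (((i + 2 : ℕ) : K) * ((i + 2 : ℕ) - 1)) with hm
    refine ⟨derivative u ^ (i + 2) + (m / ((i - d) * (i - d'))) • P, ?_, ?_⟩
    · rw [degree_add_eq_left_of_degree_lt, hpow]
      refine (degree_smul_le _ _).trans_lt ?_
      rw [hPdeg, hpow]
      exact_mod_cast (by omega : i < i + 2)
    · rw [map_add, map_smul, hP, gegenbauerOp_derivative_pow hu, ← hm, smul_smul,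
        div_mul_cancel₀ _ (mul_ne_zero hd hd'), Nat.add_sub_cancel, sub_add_cancel]

theorem exists_degree_eq_gegenbauerOp_eq_zero {u : K[X]} (hu : u.natDegree = 2) {d d' : ℕ}
    (hodd : Odd (d + d')) :
    ∃ P : K[X], P.degree = d ∧ gegenbauerOp u (d : K) d' P = 0 := by
  simpa using exists_degree_eq_gegenbauerOp_eq (K := K) hu hodd d (by simp) le_rfl

theorem linearIndependent_pair_of_degree_ne {F : Type*} [Field F] {P Q : F[X]} (hP : P ≠ 0)
    (hQ : Q ≠ 0) (hPQ : P.degree ≠ Q.degree) : LinearIndependent F ![P, Q] := by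
  refine (LinearIndependent.pair_iff' hP).2 fun a ha => ?_
  have ha0 : a ≠ 0 := by
    rintro rfl
    exact hQ (by rw [← ha, zero_smul])
  exact hPQ (by rw [← ha, smul_eq_C_mul, degree_C_mul ha0])

theorem exists_mem_ne_zero_apply_eq_zero {A V : Type*} [CommRing A] [Nontrivial A]
    [AddCommGroup V] [Module A V] {S : Submodule A V} {x y : V}
    (hx : x ∈ S) (hy : y ∈ S) (hxy : LinearIndependent A ![x, y]) (φ : V →ₗ[A] A) :
    ∃ z ∈ S, z ≠ 0 ∧ φ z = 0 := by
  by_cases hφx : φ x = 0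
  · exact ⟨x, hx, hxy.ne_zero 0, hφx⟩
  · refine ⟨φ y • x + (-φ x) • y, S.add_mem (S.smul_mem _ hx) (S.smul_mem _ hy), fun hz => ?_, ?_⟩
    · exact hφx (neg_eq_zero.1 (LinearIndependent.pair_iff.1 hxy _ _ hz).2)
    · simp only [map_add, map_smul, smul_eq_mul]
      ring

theorem exists_gegenbauerOp_eq_zero_apply_eq_zero {u : K[X]} (hu : u.natDegree = 2) {d d' : ℕ}
    (hodd : Odd (d + d')) (φ : K[X] →ₗ[K] K) :
    ∃ P : K[X], P ≠ 0 ∧ gegenbauerOp u (d : K) d' P = 0 ∧ φ P = 0 := by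
  obtain ⟨P₁, hdeg₁, hP₁⟩ := exists_degree_eq_gegenbauerOp_eq_zero (K := K) hu hodd
  obtain ⟨P₂, hdeg₂, hP₂⟩ :=
    exists_degree_eq_gegenbauerOp_eq_zero (K := K) hu (add_comm d d' ▸ hodd)
  rw [gegenbauerOp_comm] at hP₂
  have hindep : LinearIndependent K ![P₁, P₂] := by
    refine linearIndependent_pair_of_degree_ne ?_ ?_ ?_
    · rintro rfl
      simp at hdeg₁
    · rintro rfl
      simp at hdeg₂
    · rw [hdeg₁, hdeg₂]
      exact_mod_cast (by grind : d ≠ d')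
  obtain ⟨P, hP, hP0, hφP⟩ := exists_mem_ne_zero_apply_eq_zero
    (S := LinearMap.ker (gegenbauerOp u (d : K) d')) hP₁ hP₂ hindep φ
  exact ⟨P, hP0, hP, hφP⟩

end PolynomialSolutions

section Linearization

variable {𝕜 : Type*} [NontriviallyNormedField 𝕜] {f f₁ w : 𝕜 → 𝕜} {p r t : 𝕜}

theorem hasDerivAt_add_mul_of_riccati (hw : HasDerivAt w (w t ^ 2 + p * w t + r) t)
    (hf : HasDerivAt f (f₁ t) t) (hf₁ : HasDerivAt f₁ (p * f₁ t - r * f t) t) :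
    HasDerivAt (fun x => f₁ x + w x * f x) ((w t + p) * (f₁ t + w t * f t)) t :=
  (hf₁.add (hw.mul hf)).congr_deriv (by ring)

theorem hasDerivAt_neg_div_of_linear (hf : HasDerivAt f (f₁ t) t)
    (hf₁ : HasDerivAt f₁ (p * f₁ t - r * f t) t) (hft : f t ≠ 0) :
    HasDerivAt (fun x => -(f₁ x / f x)) ((-(f₁ t / f t)) ^ 2 + p * -(f₁ t / f t) + r) t :=
  (hf₁.div hf hft).neg.congr_deriv (by field_simp; ring)

end Linearization

section FirstOrder

variable {U : Set ℂ} {g : ℂ → ℂ}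

theorem eqOn_zero_of_hasDerivAt_mul {F : ℂ → ℂ} (hUo : IsOpen U) (hUc : IsPreconnected U)
    (hg : DifferentiableOn ℂ g U) (hF : ∀ t ∈ U, HasDerivAt F (g t * F t) t)
    {t₀ : ℂ} (ht₀ : t₀ ∈ U) (h0 : F t₀ = 0) : Set.EqOn F 0 U := by
  have hFan : AnalyticOnNhd ℂ F U :=
    DifferentiableOn.analyticOnNhd (fun t ht => (hF t ht).differentiableAt.differentiableWithinAt)
      hUo
  refine hFan.eqOn_zero_of_preconnected_of_eventuallyEq_zero hUc ht₀ ?_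
  obtain ⟨r, hr, hball⟩ := Metric.isOpen_iff.1 hUo t₀ ht₀
  obtain ⟨G, hG⟩ := (hg.mono hball).isExactOn_ball
  have hconst : ∀ t ∈ Metric.ball t₀ r, HasDerivAt (fun t => F t * Complex.exp (-G t)) 0 t :=
    fun t ht => ((hF t (hball ht)).mul (hG t ht).fun_neg.cexp).congr_deriv (by ring)
  filter_upwards [Metric.ball_mem_nhds t₀ hr] with t ht
  have hFt := Metric.isOpen_ball.is_const_of_deriv_eq_zero (convex_ball t₀ r).isPreconnected
    (fun x hx => (hconst x hx).differentiableAt.differentiableWithinAt)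
    (fun x hx => (hconst x hx).deriv) ht (Metric.mem_ball_self hr)
  simpa [h0, Complex.exp_ne_zero] using hFt

theorem eval_ne_zero_of_derivative_eval_eq_mul {P : ℂ[X]} (hP : P ≠ 0) (hU : IsOpen U)
    (hg : DifferentiableOn ℂ g U) (hPg : ∀ t ∈ U, (derivative P).eval t = g t * P.eval t)
    {t : ℂ} (ht : t ∈ U) : P.eval t ≠ 0 := by
  intro hPt
  obtain ⟨r, hr, hball⟩ := Metric.isOpen_iff.1 hU t ht
  have hzero : Set.EqOn (P.eval ·) 0 (Metric.ball t r) :=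
    eqOn_zero_of_hasDerivAt_mul Metric.isOpen_ball (convex_ball t r).isPreconnected
      (hg.mono hball) (fun x hx => hPg x (hball hx) ▸ P.hasDerivAt x)
      (Metric.mem_ball_self hr) hPt
  exact hP (eq_zero_of_infinite_isRoot P
    ((infinite_of_mem_nhds t (Metric.ball_mem_nhds t hr)).mono hzero))

end FirstOrder

section RiccatiEquation

/-- The logarithmic derivative of the multivalued function `u ^ ((1 - α - β) / 4)` which relates
the solutions `z` of the linear equation attached to the Riccati equation to the polynomials `P`
in the kernel of `gegenbauerOp u α β`. -/
noncomputable def gaugeTerm (α β : ℂ) (u : ℂ[X]) (t : ℂ) : ℂ :=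
  (1 - α - β) / 4 * ((derivative u).eval t / u.eval t)

/-- `y = -z'/z` on `W` for the multivalued function `z = u ^ ((1 - α - β) / 4) * P`, multiplied by
`P` so that it makes sense at the zeros of `P`. -/
def IsNegLogDerivOn (α β : ℂ) (u P : ℂ[X]) (y : ℂ → ℂ) (W : Set ℂ) : Prop :=
  ∀ t ∈ W, (derivative P).eval t + (y t + gaugeTerm α β u t) * P.eval t = 0

variable {q n : ℤ} {α β t : ℂ} {u P : ℂ[X]} {y : ℂ → ℂ} {W : Set ℂ}

theorem hasDerivAt_gaugeTerm (ht : u.eval t ≠ 0) :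
    HasDerivAt (gaugeTerm α β u) ((1 - α - β) / 4 *
      ((derivative (derivative u)).eval t / u.eval t
        - ((derivative u).eval t / u.eval t) ^ 2)) t :=
  ((((derivative u).hasDerivAt t).div (u.hasDerivAt t) ht).const_mul _).congr_deriv
    (by field_simp)

/-- The poles of order two cancel, which is what the exponent `(1 - α - β) / 4` is chosen for. -/
theorem deriv_gaugeTerm_add_sq_add_riccatiCoeff (hq : (q : ℂ) ^ 2 = ((α + β + 1) / 2) ^ 2)
    (hn : (n : ℂ) ^ 2 = (β - α) ^ 2) (ht : u.eval t ≠ 0) :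
    deriv (gaugeTerm α β u) t + gaugeTerm α β u t ^ 2 + riccatiCoeff q n u t =
      α * β / 2 * ((derivative (derivative u)).eval t / u.eval t) := by
  rw [(hasDerivAt_gaugeTerm ht).deriv, gaugeTerm, riccatiCoeff, hq, hn]
  field_simp
  ring

theorem hasDerivAt_riccati_iff_add_gaugeTerm (hq : (q : ℂ) ^ 2 = ((α + β + 1) / 2) ^ 2)
    (hn : (n : ℂ) ^ 2 = (β - α) ^ 2) (ht : u.eval t ≠ 0) :
    HasDerivAt y (y t ^ 2 + riccatiCoeff q n u t) t ↔
      HasDerivAt (fun x => y x + gaugeTerm α β u x)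
        ((y t + gaugeTerm α β u t) ^ 2
          + (-2 * gaugeTerm α β u t) * (y t + gaugeTerm α β u t)
          + α * β / 2 * ((derivative (derivative u)).eval t / u.eval t)) t := by
  have hgauge := (hasDerivAt_gaugeTerm (α := α) (β := β) ht).differentiableAt.hasDerivAt
  rw [← deriv_gaugeTerm_add_sq_add_riccatiCoeff hq hn ht]
  constructor <;> intro hy
  · exact (hy.add hgauge).congr_deriv (by ring)
  · have hsub := hy.sub hgauge
    simp only [Pi.sub_def, add_sub_cancel_right] at hsub
    exact hsub.congr_deriv (by ring)

theorem hasDerivAt_derivative_of_gegenbauerOp_eq_zero (hP : gegenbauerOp u α β P = 0)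
    (ht : u.eval t ≠ 0) :
    HasDerivAt (fun x => (derivative P).eval x)
      (-2 * gaugeTerm α β u t * (derivative P).eval t
        - α * β / 2 * ((derivative (derivative u)).eval t / u.eval t) * P.eval t) t := by
  refine ((derivative P).hasDerivAt t).congr_deriv ?_
  have hPt := congrArg (eval t) hP
  simp only [gegenbauerOp_apply, eval_add, eval_sub, eval_mul, eval_C, eval_ofNat,
    eval_zero] at hPt
  rw [gaugeTerm]
  field_simp
  linear_combination 4 * hPt

theorem IsRiccatiSolutionOn.isNegLogDerivOn (hy : IsRiccatiSolutionOn q n u y W)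
    (hq : (q : ℂ) ^ 2 = ((α + β + 1) / 2) ^ 2) (hn : (n : ℂ) ^ 2 = (β - α) ^ 2)
    (hP : gegenbauerOp u α β P = 0) (hWo : IsOpen W) (hWc : IsPreconnected W)
    {t₀ : ℂ} (ht₀ : t₀ ∈ W)
    (hPt₀ : (derivative P).eval t₀ + (y t₀ + gaugeTerm α β u t₀) * P.eval t₀ = 0) :
    IsNegLogDerivOn α β u P y W := by
  have hw (t : ℂ) (ht : t ∈ W) :=
    (hasDerivAt_riccati_iff_add_gaugeTerm hq hn (hy t ht).1).1 (hy t ht).2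
  have hgauge (t : ℂ) (ht : t ∈ W) :=
    (hasDerivAt_gaugeTerm (α := α) (β := β) (hy t ht).1).differentiableAt
  refine eqOn_zero_of_hasDerivAt_mul hWo hWc
    (g := fun t => y t + gaugeTerm α β u t + -2 * gaugeTerm α β u t) (fun t ht => ?_)
    (fun t ht => ?_) ht₀ hPt₀
  · exact ((hw t ht).differentiableAt.add ((hgauge t ht).const_mul _)).differentiableWithinAt
  · exact hasDerivAt_add_mul_of_riccati (hw t ht) (P.hasDerivAt t)
      (hasDerivAt_derivative_of_gegenbauerOp_eq_zero hP (hy t ht).1)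

theorem IsNegLogDerivOn.eval_ne_zero (hPy : IsNegLogDerivOn α β u P y W) (hP : P ≠ 0)
    (hWo : IsOpen W) (hu : ∀ t ∈ W, u.eval t ≠ 0) (hy : DifferentiableOn ℂ y W) (ht : t ∈ W) :
    P.eval t ≠ 0 := by
  refine eval_ne_zero_of_derivative_eval_eq_mul hP hWo
    (g := fun t => -(y t + gaugeTerm α β u t)) (hy.add fun t ht => ?_).neg (fun t ht => ?_) ht
  · exact (hasDerivAt_gaugeTerm (hu t ht)).differentiableAt.differentiableWithinAt
  · linear_combination hPy t ht

theorem IsNegLogDerivOn.add_gaugeTerm_eq (hPy : IsNegLogDerivOn α β u P y W) (ht : t ∈ W)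
    (hPt : P.eval t ≠ 0) :
    y t + gaugeTerm α β u t = -((derivative P).eval t / P.eval t) := by
  field_simp
  linear_combination hPy t ht

theorem IsNegLogDerivOn.isRiccatiSolutionOn (hPy : IsNegLogDerivOn α β u P y W)
    (hq : (q : ℂ) ^ 2 = ((α + β + 1) / 2) ^ 2) (hn : (n : ℂ) ^ 2 = (β - α) ^ 2)
    (hP0 : P ≠ 0) (hP : gegenbauerOp u α β P = 0) (hWo : IsOpen W)
    (hu : ∀ t ∈ W, u.eval t ≠ 0) (hy : DifferentiableOn ℂ y W) :
    IsRiccatiSolutionOn q n u y W := by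
  refine fun t ht => ⟨hu t ht, (hasDerivAt_riccati_iff_add_gaugeTerm hq hn (hu t ht)).2 ?_⟩
  have hw {x : ℂ} (hx : x ∈ W) := hPy.add_gaugeTerm_eq hx (hPy.eval_ne_zero hP0 hWo hu hy hx)
  have hlog := hasDerivAt_neg_div_of_linear (f₁ := fun x => (derivative P).eval x)
    (P.hasDerivAt t) (hasDerivAt_derivative_of_gegenbauerOp_eq_zero hP (hu t ht))
    (hPy.eval_ne_zero hP0 hWo hu hy ht)
  rw [hw ht]
  refine hlog.congr_of_eventuallyEq ?_
  filter_upwards [hWo.mem_nhds ht] with x hx using hw hx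

end RiccatiEquation

section RationalFunctions

theorem ratFun_eq_div (R : RatFunc ℂ) : ratFun R = fun t => R.num.eval t / R.denom.eval t := by
  funext t
  simp only [ratFun, RatFunc.eval, eval₂_id]

theorem meromorphic_ratFun (R : RatFunc ℂ) : Meromorphic (ratFun R) := by
  rw [ratFun_eq_div]
  exact fun t => (R.num.differentiable.analyticAt t).meromorphicAt.div
    (R.denom.differentiable.analyticAt t).meromorphicAt

theorem differentiableAt_ratFun {R : RatFunc ℂ} {t : ℂ} (ht : R.denom.eval t ≠ 0) :
    DifferentiableAt ℂ (ratFun R) t := by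
  rw [ratFun_eq_div]
  exact R.num.differentiableAt.div R.denom.differentiableAt ht

theorem ratFun_mul_eval_eq {R : RatFunc ℂ} {p d : ℂ[X]} (hd : d ≠ 0)
    (hR : R = algebraMap ℂ[X] (RatFunc ℂ) p / algebraMap ℂ[X] (RatFunc ℂ) d) {t : ℂ}
    (ht : R.denom.eval t ≠ 0) : ratFun R t * d.eval t = p.eval t := by
  have hcross := congrArg (eval t) ((RatFunc.num_mul_eq_mul_denom_iff hd).2 hR)
  rw [eval_mul, eval_mul] at hcross
  rw [ratFun_eq_div, div_mul_eq_mul_div, hcross, mul_div_cancel_right₀ _ ht]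

theorem eval_denom_div_ne_zero {p d : ℂ[X]} {t : ℂ} (ht : d.eval t ≠ 0) :
    (algebraMap ℂ[X] (RatFunc ℂ) p / algebraMap ℂ[X] (RatFunc ℂ) d).denom.eval t ≠ 0 :=
  fun h0 => ht (eval_eq_zero_of_dvd_of_eval_eq_zero (RatFunc.denom_div_dvd p d) h0)

theorem exists_ratFunc_isNegLogDerivOn (α β : ℂ) {u P : ℂ[X]} (hu : u ≠ 0) (hP : P ≠ 0) :
    ∃ R : RatFunc ℂ,
      IsNegLogDerivOn α β u P (ratFun R) {t | u.eval t ≠ 0 ∧ R.denom.eval t ≠ 0} ∧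
      ∀ t, u.eval t ≠ 0 → P.eval t ≠ 0 → R.denom.eval t ≠ 0 := by
  refine ⟨algebraMap ℂ[X] (RatFunc ℂ)
      (-(u * derivative P + C ((1 - α - β) / 4) * derivative u * P)) /
    algebraMap ℂ[X] (RatFunc ℂ) (u * P), fun t ht => ?_, fun t hut hPt => ?_⟩
  · have hmul := ratFun_mul_eval_eq (mul_ne_zero hu hP) rfl ht.2
    simp only [eval_neg, eval_add, eval_mul, eval_C] at hmul
    have hut := ht.1
    rw [gaugeTerm]
    field_simp
    linear_combination 4 * hmul
  · exact eval_denom_div_ne_zero (by rw [eval_mul]; exact mul_ne_zero hut hPt)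

end RationalFunctions

theorem exists_nat_exponents {q n : ℤ} (hn : Odd n) (hnq : |n| < 2 * |q|) :
    ∃ d d' : ℕ, Odd (d + d') ∧ (q : ℂ) ^ 2 = (((d : ℂ) + d' + 1) / 2) ^ 2 ∧
      (n : ℂ) ^ 2 = ((d' : ℂ) - d) ^ 2 := by
  obtain ⟨k, rfl⟩ := hn
  obtain ⟨d, hd⟩ := Int.eq_ofNat_of_zero_le (show 0 ≤ |q| - k - 1 by grind)
  obtain ⟨d', hd'⟩ := Int.eq_ofNat_of_zero_le (show 0 ≤ |q| + k by grind)
  refine ⟨d, d', by grind, ?_, ?_⟩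
  · have hsum : (d : ℂ) + d' + 1 = 2 * (|q| : ℤ) := by
      exact_mod_cast (by omega : (d : ℤ) + d' + 1 = 2 * |q|)
    rw [hsum, mul_div_cancel_left₀ _ two_ne_zero]
    exact_mod_cast (sq_abs q).symm
  · have hdiff : (d' : ℂ) - d = (2 * k + 1 : ℤ) := by
      exact_mod_cast (by omega : (d' : ℤ) - d = 2 * k + 1)
    rw [hdiff]

theorem mainTheorem5 (u : Polynomial ℂ) (hu : u.natDegree = 2) (q n : ℤ) (hq : q ^ 2 ≠ 1)
    (hn : Odd n) (hnq : |n| < 2 * |q|)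
    (U : Set ℂ) (hUo : IsOpen U) (hUc : IsConnected U)
    (y : ℂ → ℂ) (hy : IsRiccatiSolutionOn q n u y U) :
    ∃ R : RatFunc ℂ,
      Meromorphic (ratFun R) ∧
      Set.EqOn y (ratFun R) U ∧
      IsRiccatiSolutionOn q n u (ratFun R)
        {t : ℂ | u.eval t ≠ 0 ∧ R.denom.eval t ≠ 0} := by
  obtain ⟨d, d', hodd, hqd, hnd⟩ := exists_nat_exponents hn hnq
  obtain ⟨t₀, ht₀⟩ := hUc.nonempty
  obtain ⟨P, hP0, hP, hPt₀⟩ := exists_gegenbauerOp_eq_zero_apply_eq_zero hu hodd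
    (leval t₀ ∘ₗ derivative + (y t₀ + gaugeTerm d d' u t₀) • leval t₀)
  have hPy : IsNegLogDerivOn d d' u P y U :=
    hy.isNegLogDerivOn hqd hnd hP hUo hUc.isPreconnected ht₀ hPt₀
  have hPU (t : ℂ) (ht : t ∈ U) : P.eval t ≠ 0 :=
    hPy.eval_ne_zero hP0 hUo (fun t ht => (hy t ht).1)
      (fun t ht => (hy t ht).2.differentiableAt.differentiableWithinAt) ht
  obtain ⟨R, hPR, hRdenom⟩ := exists_ratFunc_isNegLogDerivOn d d'
    (ne_zero_of_natDegree_gt (hu ▸ zero_lt_two)) hP0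
  have hopen : IsOpen {t : ℂ | u.eval t ≠ 0 ∧ R.denom.eval t ≠ 0} :=
    (isOpen_ne_fun u.continuous continuous_const).inter
      (isOpen_ne_fun R.denom.continuous continuous_const)
  refine ⟨R, meromorphic_ratFun R, fun t ht => ?_, ?_⟩
  · have hut := (hy t ht).1
    exact add_right_cancel ((hPy.add_gaugeTerm_eq ht (hPU t ht)).trans
      (hPR.add_gaugeTerm_eq ⟨hut, hRdenom t hut (hPU t ht)⟩ (hPU t ht)).symm)
  · exact hPR.isRiccatiSolutionOn hqd hnd hP0 hP hopen (fun t ht => ht.1)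
      (fun t ht => (differentiableAt_ratFun ht.2).differentiableWithinAt)
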